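/- Let $r_1,r_2,r_3,\dots$ be positive integers. Define finite groups recursively by $W(r|_0)=1$ and $W(r|_k)=W(r|_{k-1})\wr \mathbb Z_{r_k}=W(r|_{k-1})^{r_k}\rtimes\mathbb Z_{r_k}$, where $\mathbb Z_{r_k}$ permutes the $r_k$ factors cyclically, and let $M(r|_k)$ be the number of isomorphism classes of irreducible complex representations of $W(r|_k)$. Each $M(r|_k)$ is finite, $M(r|_1)=r_1$, and for every $k\ge 1$ $$M(r|_k)=\frac1{r_k}\sum_{d\mid r_k} f(d)\,d^2=\frac1{r_k}\sum_{d\mid c\mid r_k}\mu(c/d)\,M(r|_{k-1})^{r_k/c}\,d^2 .$$ Here $\mu$ is the Möbius function, the last sum runs over all pairs $(c,d)$ of positive integers with $d\mid c$ and $c\mid r_k$, and $f(d)$ is the number of words of length $r_k$ over an alphabet of $M(r|_{k-1})$ letters whose stabilizer under the cyclic rotation action of $\mathbb Z_{r_k}$ has order exactly $d$ (equivalently, whose least period is $r_k/d$). -/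

import Mathlib

/-- The underlying type of the generalized iterated wreath product `W(r|_k)`:
`W(r|_0)` is trivial and `W(r|_k) = W(r|_{k-1}) ≀ ℤ/r_k`, where `ℤ/r_k` permutes the `r_k`
factors of the base group `W(r|_{k-1})^{r_k}` cyclically.
Here `r i` stands for `r_i`, `i ≥ 1`; the value `r 0` is not used. -/
def CyclicWreath (r : ℕ → ℕ) : ℕ → Type
  | 0 => PUnit
  | k + 1 => RegularWreathProduct (CyclicWreath r k) (Multiplicative (ZMod (r (k + 1))))

/-- The group structure of `W(r|_k)`. -/
instance CyclicWreath.instGroup (r : ℕ → ℕ) : (k : ℕ) → Group (CyclicWreath r k)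
  | 0 => inferInstanceAs (Group PUnit)
  | k + 1 =>
    @RegularWreathProduct.instGroup (CyclicWreath r k) (Multiplicative (ZMod (r (k + 1))))
      (CyclicWreath.instGroup r k) inferInstance

/-- A finite-dimensional irreducible complex representation of the group `G`. -/
structure IrreducibleRep (G : Type) [Group G] where
  V : Type
  [addCommGroup : AddCommGroup V]
  [module : Module ℂ V]
  [finiteDimensional : FiniteDimensional ℂ V]
  ρ : Representation ℂ G V
  irreducible : ρ.IsIrreducible

attribute [instance] IrreducibleRep.addCommGroup IrreducibleRep.module
  IrreducibleRep.finiteDimensional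

/-- Isomorphism of irreducible representations. -/
instance IrreducibleRep.setoid (G : Type) [Group G] : Setoid (IrreducibleRep G) where
  r σ τ := Nonempty (σ.ρ.Equiv τ.ρ)
  iseqv :=
    { refl := fun σ => ⟨Representation.Equiv.refl σ.ρ⟩
      symm := fun ⟨e⟩ => ⟨e.symm⟩
      trans := fun ⟨e⟩ ⟨e'⟩ => ⟨e.trans e'⟩ }

/-- The isomorphism classes of irreducible complex representations of `G`. -/
def IrrepClass (G : Type) [Group G] : Type 1 :=
  Quotient (IrreducibleRep.setoid G)

/-- `M(r|_k)`: the number of isomorphism classes of irreducible representations of `W(r|_k)`. -/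
noncomputable def numIrreps (r : ℕ → ℕ) (k : ℕ) : ℕ :=
  Nat.card (IrrepClass (CyclicWreath r k))

/-- The stabilizer in `ℤ/n` of a word `x` of length `n`, with positions indexed by `ℤ/n`, under
cyclic rotation of the positions. -/
def rotationStabilizer {n : ℕ} {α : Type} (x : ZMod n → α) : AddSubgroup (ZMod n) where
  carrier := {s | ∀ i, x (i + s) = x i}
  zero_mem' := fun i => by rw [add_zero]
  add_mem' := fun {a b} ha hb i => by rw [← add_assoc, hb, ha]
  neg_mem' := fun {a} ha i => by
    have h := ha (i + -a)
    rw [neg_add_cancel_right] at h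
    exact h.symm

/-- The number `f(d)` of words of length `n` over an alphabet of `h` letters whose stabilizer under
cyclic rotation has order `d` (for `n ≥ 1` and `d ∣ n`: whose least period is `n / d`). -/
noncomputable def numWordsStab (n h d : ℕ) : ℕ :=
  Nat.card {x : ZMod n → Fin h // Nat.card (rotationStabilizer x) = d}

/-!
The number of irreducible representations of a finite group is its number of conjugacy classes,
so the theorem counts the conjugacy classes of a wreath product `D ≀ᵣ Q` with `Q` cyclic of
order `n`.

*Representations and conjugacy classes.* The irreducible characters are linearly independent class
functions by orthogonality. They span: a functional on class functions that kills every character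
is the pairing with some class function `a`; by Schur's lemma the central element `∑ a(g) g` of the
group algebra acts by zero on every irreducible representation, and so it is zero because the
group algebra is semisimple (`IrrepClass.card_eq_card_conjClasses`).

*Conjugacy classes of `D ≀ᵣ Q`.* In a finite group, the number of commuting pairs is the order of
the group times its number of conjugacy classes. The commuting pairs of `D ≀ᵣ Q` are sorted by
their images `(s, t)` in `Q`. There are `|D| ^ n` times as many of them over `(s, t)` as there are
words `Q → ConjClasses D` invariant under `s` and `t` (`commPairCard_eq`). For `s = 1` this is a
count of centralizers, coordinate by coordinate. The general case reduces to it by the Euclidean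
algorithm, because `(g, h) ↦ (g * h ^ j, h)` preserves commuting pairs, as passing from `(s, t)` to
`(s * t ^ j, t)` preserves the invariant words. Summing over `(s, t)`, the number of conjugacy
classes of `D ≀ᵣ Q` times `n` is `∑ |Stab x| ^ 2`, over all words `x` of length `n` in the classes
of `D`.

*The two formulas.* Sorting the words by the order of their stabilizer gives the first one. For the
second, Möbius inversion writes `m ^ 2` as the sum over `c ∣ m` of `∑ d ∣ c, μ (c / d) * d ^ 2`, and
the words whose stabilizer has order divisible by `c` are those of period `n / c`, of which an
alphabet of `h` letters has `h ^ (n / c)`.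
-/

/-! ### Irreducible characters form a basis of the class functions -/

section Characters

open scoped MonoidAlgebra

variable {G : Type} [Group G]

/-- The character of an irreducible representation, as a function on conjugacy classes. -/
noncomputable def IrreducibleRep.classFun (σ : IrreducibleRep G) : ConjClasses G → ℂ :=
  Quotient.lift σ.ρ.character fun a b h => by
    obtain ⟨c, rfl⟩ := isConj_iff.1 h
    rw [Representation.char_conj]

@[simp]
theorem IrreducibleRep.classFun_mk (σ : IrreducibleRep G) (g : G) :
    σ.classFun (ConjClasses.mk g) = σ.ρ.character g := rfl

/-- The character attached to an isomorphism class of irreducible representations. -/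
noncomputable def IrrepClass.char (q : IrrepClass G) : ConjClasses G → ℂ :=
  Quotient.lift IrreducibleRep.classFun (fun σ τ h => by
    obtain ⟨e⟩ := h
    ext c
    obtain ⟨g, rfl⟩ := ConjClasses.exists_rep c
    simp [Representation.char_iso e]) q

theorem IrrepClass.sum_char_mul_char_inv [Fintype G] (p q : IrrepClass G) :
    open Classical in ∑ g : G, p.char (.mk g) * q.char (.mk g⁻¹) =
      if p = q then (Nat.card G : ℂ) else 0 := by
  classical
  have hG : (Nat.card G : ℂ) ≠ 0 := Nat.cast_ne_zero.2 Nat.card_pos.ne'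
  let _ := invertibleOfNonzero hG
  obtain ⟨σ, rfl⟩ := Quotient.exists_rep p
  obtain ⟨τ, rfl⟩ := Quotient.exists_rep q
  have := σ.irreducible
  have := τ.irreducible
  have h := Representation.char_orthonormal σ.ρ τ.ρ
  rw [inv_mul_eq_iff_eq_mul₀ hG, mul_ite, mul_one, mul_zero] at h
  exact h.trans (if_congr
    ⟨fun ⟨e⟩ => Quotient.sound ⟨e.symm⟩, fun h => (Quotient.exact h).map (·.symm)⟩ rfl rfl)

theorem IrrepClass.linearIndependent_char [Finite G] :
    LinearIndependent ℂ (IrrepClass.char : IrrepClass G → ConjClasses G → ℂ) := by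
  classical
  have := Fintype.ofFinite G
  rw [linearIndependent_iff']
  intro s c hc p hp
  have key : ∑ g : G, (∑ q ∈ s, c q • q.char) (.mk g) * p.char (.mk g⁻¹) = c p * Nat.card G := by
    simp only [Finset.sum_apply, Pi.smul_apply, smul_eq_mul, Finset.sum_mul, mul_assoc]
    rw [Finset.sum_comm]
    simp only [← Finset.mul_sum, IrrepClass.sum_char_mul_char_inv]
    simp [hp]
  rw [hc] at key
  simpa [Nat.card_pos.ne', eq_comm] using key

instance IrrepClass.instFinite [Finite G] : Finite (IrrepClass G) :=
  have := Fintype.ofFinite (ConjClasses G)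
  (Module.Finite.finite_basis (Module.Basis.span IrrepClass.linearIndependent_char))

/-- By Schur's lemma, a central element of the group algebra acts on an irreducible
representation by a scalar; so it acts by zero as soon as its trace is zero. -/
theorem IrreducibleRep.sum_smul_eq_zero [Fintype G] (σ : IrreducibleRep G) (a : ConjClasses G → ℂ)
    (h : ∑ g : G, a (.mk g) * σ.classFun (.mk g) = 0) :
    ∑ g : G, a (.mk g) • σ.ρ g = 0 := by
  have := σ.irreducible
  have hcomm (x : G) : (∑ g : G, a (.mk g) • σ.ρ g) * σ.ρ x =
      σ.ρ x * ∑ g : G, a (.mk g) • σ.ρ g := by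
    rw [Finset.sum_mul, Finset.mul_sum]
    refine Fintype.sum_equiv (MulAut.conj x⁻¹).toEquiv _ _ fun g => ?_
    have hc : ConjClasses.mk (x⁻¹ * g * x) = ConjClasses.mk g :=
      ConjClasses.mk_eq_mk_iff_isConj.2 (isConj_iff.2 ⟨x, by group⟩)
    simp only [smul_mul_assoc, mul_smul_comm, MulEquiv.toEquiv_eq_coe,
      EquivLike.coe_coe, MulAut.conj_apply, inv_inv, hc, ← map_mul]
    congr 2
    group
  let T : Representation.IntertwiningMap σ.ρ σ.ρ := ⟨∑ g : G, a (.mk g) • σ.ρ g, hcomm⟩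
  obtain ⟨c, hc⟩ :=
    (Representation.IsIrreducible.algebraMap_intertwiningMap_bijective_of_isAlgClosed
      (ρ := σ.ρ)).2 T
  have hT : ∑ g : G, a (.mk g) • σ.ρ g = c • LinearMap.id :=
    (congrArg Representation.IntertwiningMap.toLinearMap hc).symm
  have htr := congrArg (LinearMap.trace ℂ σ.V) hT
  simp only [map_sum, map_smul, LinearMap.trace_id, smul_eq_mul] at htr
  have h0 : c * (Module.finrank ℂ σ.V : ℂ) = 0 := htr.symm.trans h
  have : Nontrivial σ.V := by
    by_contra hV
    rw [not_nontrivial_iff_subsingleton] at hV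
    refine bot_ne_top (α := Subrepresentation σ.ρ) (SetLike.ext fun v => ?_)
    rw [Subsingleton.elim v 0]
    exact ⟨fun _ => Submodule.zero_mem ⊤, fun _ => Submodule.zero_mem ⊥⟩
  rw [hT, (mul_eq_zero.1 h0).resolve_right (Nat.cast_ne_zero.2 Module.finrank_pos.ne'), zero_smul]

/-- An element of the group algebra that acts by zero on every irreducible representation
vanishes, because the group algebra is a semisimple module over itself. -/
theorem MonoidAlgebra.eq_zero_of_forall_irreducibleRep [Finite G] (z : ℂ[G])
    (h : ∀ σ : IrreducibleRep G, σ.ρ.asAlgebraHom z = 0) : z = 0 := by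
  have := Fintype.ofFinite G
  have : NeZero (Nat.card G : ℂ) := ⟨Nat.cast_ne_zero.2 Nat.card_pos.ne'⟩
  have hsimple (S : Submodule ℂ[G] ℂ[G]) (hS : IsSimpleModule ℂ[G] S) (s : ℂ[G]) (hs : s ∈ S) :
      z * s = 0 := by
    let ρ : Representation ℂ G S := Representation.ofModule' S
    have hρ : ρ.asAlgebraHom = Algebra.lsmul ℂ ℂ S :=
      (MonoidAlgebra.lift ℂ (S →ₗ[ℂ] S) G).apply_symm_apply _
    let e : ρ.asModule ≃ₗ[ℂ[G]] S :=
      { ρ.asModuleEquiv.toAddEquiv with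
        map_smul' := fun r x => by
          change ρ.asModuleEquiv (r • x) = r • ρ.asModuleEquiv x
          rw [Representation.asModuleEquiv_map_smul, hρ]
          rfl }
    have hirr : ρ.IsIrreducible :=
      (Representation.irreducible_iff_isSimpleModule_asModule ρ).2 (IsSimpleModule.congr e)
    have h0 := h ⟨S, ρ, hirr⟩
    rw [hρ] at h0
    exact congrArg Subtype.val (LinearMap.congr_fun h0 ⟨s, hs⟩)
  have hann : z ∈ Module.annihilator ℂ[G] ℂ[G] := by
    rw [← Submodule.annihilator_top, ← IsSemisimpleModule.sSup_simples_eq_top, sSup_eq_iSup',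
      Submodule.annihilator_iSup, Submodule.mem_iInf]
    exact fun S => Submodule.mem_annihilator.2 fun s hs => hsimple S.1 S.2 s hs
  simpa using Module.mem_annihilator.1 hann 1

theorem IrrepClass.span_char [Finite G] :
    Submodule.span ℂ (Set.range (IrrepClass.char : IrrepClass G → ConjClasses G → ℂ)) = ⊤ := by
  classical
  have := Fintype.ofFinite G
  have : Fintype (ConjClasses G) := Fintype.ofFinite _
  by_contra hne
  obtain ⟨φ, hφ0, hφ⟩ := Submodule.exists_le_ker_of_lt_top _ (lt_top_iff_ne_top.2 hne)
  -- Dividing by the class sizes `N c` writes `φ` as a pairing `f ↦ ∑ g, a(g) f(g)` over the group.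
  let N (c : ConjClasses G) : ℂ := (Finset.univ.filter fun g : G => ConjClasses.mk g = c).card
  have hN (c : ConjClasses G) : N c ≠ 0 := by
    obtain ⟨g, rfl⟩ := ConjClasses.exists_rep c
    exact Nat.cast_ne_zero.2 (Finset.card_ne_zero.2 ⟨g, by simp⟩)
  let a (c : ConjClasses G) : ℂ := φ (Pi.single c 1) / N c
  have hφa (f : ConjClasses G → ℂ) : ∑ g : G, a (.mk g) * f (.mk g) = φ f := by
    rw [← Finset.sum_fiberwise (g := (ConjClasses.mk : G → ConjClasses G))]
    rw [LinearMap.pi_apply_eq_sum_univ φ f]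
    refine Finset.sum_congr rfl fun c _ => ?_
    rw [Finset.sum_congr rfl (g := fun _ => a c * f c) fun g hg => by
      rw [(Finset.mem_filter.1 hg).2]]
    simp only [Finset.sum_const, nsmul_eq_mul, smul_eq_mul]
    change N c * (φ (Pi.single c 1) / N c * f c) = _
    rw [← mul_assoc, mul_div_cancel₀ _ (hN c), mul_comm]
    congr 3
    ext i
    simp [Pi.single_apply, eq_comm]
  let z : ℂ[G] := ∑ g : G, MonoidAlgebra.single g (a (.mk g))
  have hz : z = 0 := MonoidAlgebra.eq_zero_of_forall_irreducibleRep z fun σ => by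
    simp only [z, map_sum, Representation.asAlgebraHom_single]
    refine σ.sum_smul_eq_zero a ?_
    rw [hφa]
    exact hφ (Submodule.subset_span ⟨Quotient.mk _ σ, rfl⟩)
  have ha (g : G) : a (.mk g) = 0 := by
    have := congrArg (fun w : ℂ[G] => w.coeff g) hz
    simpa [z, Finsupp.single_apply] using this
  refine hφ0 (LinearMap.ext fun f => ?_)
  rw [← hφa]
  simp [ha]

theorem IrrepClass.card_eq_card_conjClasses [Finite G] :
    Nat.card (IrrepClass G) = Nat.card (ConjClasses G) := by
  have : Fintype (ConjClasses G) := Fintype.ofFinite _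
  have b := Module.Basis.mk (IrrepClass.linearIndependent_char (G := G)) IrrepClass.span_char.ge
  rw [← Module.finrank_eq_nat_card_basis b, Module.finrank_fintype_fun_eq_card,
    Nat.card_eq_fintype_card]

end Characters

/-! ### Conjugacy classes of a wreath product with a cyclic group -/

section Transporter

variable {D : Type*} [Group D]

/-- The number of elements conjugating `u` to `v`. -/
noncomputable def transporterCard (u v : D) : ℕ :=
  Nat.card {d : D // u * d = d * v}

/-- The order of the centralizer of any element of the conjugacy class `c`. -/
noncomputable def ConjClasses.centralizerCard (c : ConjClasses D) : ℕ :=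
  transporterCard (Quotient.out c) (Quotient.out c)

theorem transporterCard_mul_mul_inv (u v h k : D) :
    transporterCard (h * u * h⁻¹) (k * v * k⁻¹) = transporterCard u v := by
  refine Nat.card_congr (((Equiv.mulLeft h⁻¹).trans (Equiv.mulRight k)).subtypeEquiv fun d => ?_)
  simp only [Equiv.trans_apply, Equiv.coe_mulLeft, Equiv.coe_mulRight]
  constructor
  · intro e
    have := congrArg (fun t => h⁻¹ * t * k) e
    simpa [mul_assoc] using this
  · intro e
    have := congrArg (fun t => h * t * k⁻¹) e
    simpa [mul_assoc] using this

theorem transporterCard_eq [DecidableEq (ConjClasses D)] (u v : D) :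
    transporterCard u v =
      if ConjClasses.mk u = ConjClasses.mk v then (ConjClasses.mk u).centralizerCard else 0 := by
  split_ifs with h
  · have h1 : IsConj u (Quotient.out (ConjClasses.mk u)) :=
      (ConjClasses.mk_eq_mk_iff_isConj.1 (Quotient.out_eq (ConjClasses.mk u))).symm
    obtain ⟨a, ha⟩ := isConj_iff.1 h1
    obtain ⟨b, hb⟩ := isConj_iff.1 ((ConjClasses.mk_eq_mk_iff_isConj.1 h).symm.trans h1)
    rw [ConjClasses.centralizerCard, ← transporterCard_mul_mul_inv u v a b, ha, hb]
  · rw [transporterCard, Nat.card_eq_zero]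
    exact .inl ⟨fun d => h (ConjClasses.mk_eq_mk_iff_isConj.2
      (isConj_iff.2 ⟨d.1⁻¹, by simp [mul_assoc, d.2]⟩))⟩

theorem sum_transporterCard [Fintype D] (u : D) : ∑ v, transporterCard u v = Nat.card D := by
  refine (Nat.card_sigma (β := fun v => {d : D // u * d = d * v})).symm.trans ?_
  exact Nat.card_congr
    { toFun := fun p => p.2.1
      invFun := fun d => ⟨d⁻¹ * u * d, d, by group⟩
      left_inv := by
        rintro ⟨v, d, hd⟩
        obtain rfl : v = d⁻¹ * u * d := by rw [mul_assoc, hd, inv_mul_cancel_left]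
        rfl
      right_inv := fun d => rfl }

/-- The orbit-stabilizer theorem for conjugation. -/
theorem ConjClasses.card_fiber_mul_centralizerCard [Finite D] (c : ConjClasses D) :
    Nat.card {v : D // ConjClasses.mk v = c} * c.centralizerCard = Nat.card D := by
  classical
  have := Fintype.ofFinite D
  obtain ⟨u, rfl⟩ := ConjClasses.exists_rep c
  rw [← sum_transporterCard u]
  simp only [transporterCard_eq, Finset.sum_ite, Finset.sum_const_zero, add_zero, Finset.sum_const,
    smul_eq_mul, Nat.card_eq_fintype_card, Fintype.card_subtype, eq_comm]

end Transporter

section Wreath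

variable {D Q : Type*} [Group D] [CommGroup Q]

/-- The number of commuting pairs in `D ≀ᵣ Q` lying over the pair `(s, t)` of elements of `Q`. -/
noncomputable def commPairCard (D : Type*) {Q : Type*} [Group D] [CommGroup Q] (s t : Q) : ℕ :=
  Nat.card {p : (D ≀ᵣ Q) × (D ≀ᵣ Q) // Commute p.1 p.2 ∧ p.1.right = s ∧ p.2.right = t}

/-- The number of words in the alphabet `α`, indexed by `Q`, which are invariant under the
translations by `s` and by `t`. -/
noncomputable def fixedWordCard (α : Type*) {Q : Type*} [CommGroup Q] (s t : Q) : ℕ :=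
  Nat.card {x : Q → α // (∀ q, x (s * q) = x q) ∧ ∀ q, x (t * q) = x q}

theorem commPairCard_comm (s t : Q) : commPairCard D s t = commPairCard D t s :=
  Nat.card_congr ((Equiv.prodComm _ _).subtypeEquiv fun p => by
    simp only [Equiv.prodComm_apply, Prod.fst_swap, Prod.snd_swap, and_comm (a := p.1.right = s)]
    exact and_congr_left fun _ => ⟨Commute.symm, Commute.symm⟩)

theorem fixedWordCard_comm {α : Type*} (s t : Q) : fixedWordCard α s t = fixedWordCard α t s :=
  Nat.card_congr (Equiv.subtypeEquivRight fun _ => and_comm)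

theorem commPairCard_mul_pow (s t : Q) (j : ℕ) :
    commPairCard D (s * t ^ j) t = commPairCard D s t := by
  let e : (D ≀ᵣ Q) × (D ≀ᵣ Q) ≃ (D ≀ᵣ Q) × (D ≀ᵣ Q) :=
    { toFun := fun p => (p.1 * p.2 ^ j, p.2)
      invFun := fun p => (p.1 * (p.2 ^ j)⁻¹, p.2)
      left_inv := fun p => by simp
      right_inv := fun p => by simp }
  symm
  refine Nat.card_congr (e.subtypeEquiv fun p => ?_)
  have hright : (p.1 * p.2 ^ j).right = p.1.right * p.2.right ^ j := by
    rw [RegularWreathProduct.mul_right]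
    exact congrArg _ (map_pow (RegularWreathProduct.rightHom (D := D) (Q := Q)) p.2 j)
  have hcomm : Commute (p.1 * p.2 ^ j) p.2 ↔ Commute p.1 p.2 := by
    refine ⟨fun h => ?_, fun h => h.mul_left (Commute.pow_self p.2 j)⟩
    simpa using h.mul_left ((Commute.pow_self p.2 j).inv_left)
  change _ ↔ Commute (p.1 * p.2 ^ j) p.2 ∧ (p.1 * p.2 ^ j).right = s * t ^ j ∧ p.2.right = t
  rw [hcomm, hright]
  refine and_congr_right fun _ => ?_
  constructor
  · rintro ⟨h1, h2⟩
    rw [h1, h2]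
    exact ⟨rfl, rfl⟩
  · rintro ⟨h1, h2⟩
    rw [h2] at h1
    exact ⟨mul_right_cancel h1, h2⟩

theorem fixedWordCard_mul_pow {α : Type*} (s t : Q) (j : ℕ) :
    fixedWordCard α (s * t ^ j) t = fixedWordCard α s t := by
  refine Nat.card_congr (Equiv.subtypeEquivRight fun x => and_congr_left fun h => ?_)
  have hj (q : Q) : x (t ^ j * q) = x q := by
    induction j with
    | zero => simp
    | succ j ih => rw [pow_succ', mul_assoc, h, ih]
  refine forall_congr' fun q => ?_
  rw [mul_comm s, mul_assoc, hj]

variable [Finite D] [Finite Q]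

theorem commPairCard_one_left (t : Q) :
    commPairCard D 1 t = Nat.card D ^ Nat.card Q * fixedWordCard (ConjClasses D) 1 t := by
  classical
  have := Fintype.ofFinite D
  have := Fintype.ofFinite Q
  have := Fintype.ofFinite (ConjClasses D)
  -- A pair `(a, b)` over `(1, t)` commutes iff `b x` conjugates `a x` to `a (t⁻¹ * x)` for all `x`.
  let e : {p : (D ≀ᵣ Q) × (D ≀ᵣ Q) // Commute p.1 p.2 ∧ p.1.right = 1 ∧ p.2.right = t} ≃
      (a : Q → D) × ((x : Q) → {d : D // a x * d = d * a (t⁻¹ * x)}) :=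
    { toFun := fun p => ⟨p.1.1.left, fun x => ⟨p.1.2.left x, by
        have := congrFun (congrArg RegularWreathProduct.left p.2.1) x
        simpa [p.2.2.1, p.2.2.2] using this⟩⟩
      invFun := fun p => ⟨(⟨p.1, 1⟩, ⟨fun x => (p.2 x).1, t⟩), by
        refine ⟨RegularWreathProduct.ext (funext fun x => ?_) (by simp), rfl, rfl⟩
        have hx : (1 : Q)⁻¹ * x = x := by simp
        exact (congrArg (fun y => p.1 x * (p.2 y).1) hx).trans (p.2 x).2⟩
      left_inv := by
        rintro ⟨⟨⟨a, s⟩, ⟨b, t'⟩⟩, h, h1, h2⟩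
        obtain rfl : s = 1 := h1
        obtain rfl : t' = t := h2
        rfl
      right_inv := fun p => rfl }
  rw [commPairCard, Nat.card_congr e, Nat.card_sigma]
  have hprod (a : Q → D) : Nat.card ((x : Q) → {d : D // a x * d = d * a (t⁻¹ * x)}) =
      if ∀ x, ConjClasses.mk (a (t * x)) = ConjClasses.mk (a x) then
        ∏ x, (ConjClasses.mk (a x)).centralizerCard else 0 := by
    rw [Nat.card_pi]
    change ∏ x, transporterCard (a x) (a (t⁻¹ * x)) = _
    simp only [transporterCard_eq]
    rw [Finset.prod_ite_zero]
    have hiff : (∀ x ∈ Finset.univ, ConjClasses.mk (a x) = ConjClasses.mk (a (t⁻¹ * x))) ↔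
        ∀ x, ConjClasses.mk (a (t * x)) = ConjClasses.mk (a x) :=
      ⟨fun h x => by simpa using h (t * x) (Finset.mem_univ _),
        fun h x _ => by simpa using h (t⁻¹ * x)⟩
    simp only [hiff]
  -- Group the `a` by the word of their conjugacy classes.
  let W : (Q → D) → Q → ConjClasses D := fun a x => ConjClasses.mk (a x)
  simp only [hprod]
  rw [← Finset.sum_fiberwise (g := W)]
  have hfiber (w : Q → ConjClasses D) :
      (∑ a with W a = w, if ∀ x, ConjClasses.mk (a (t * x)) = ConjClasses.mk (a x) then
        ∏ x, (ConjClasses.mk (a x)).centralizerCard else 0) =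
      if ∀ x, w (t * x) = w x then Nat.card D ^ Nat.card Q else 0 := by
    rw [Finset.sum_congr rfl (g := fun _ => if ∀ x, w (t * x) = w x then
        ∏ x, (w x).centralizerCard else 0) fun a ha => by
      rw [← (Finset.mem_filter.1 ha).2]]
    rw [Finset.sum_const, smul_ite, smul_zero]
    refine if_congr Iff.rfl ?_ rfl
    have hcard : (Finset.univ.filter fun a => W a = w).card =
        ∏ x, Nat.card {v : D // ConjClasses.mk v = w x} := by
      rw [← Nat.card_pi, ← Fintype.card_subtype, ← Nat.card_eq_fintype_card]
      exact Nat.card_congr ((Equiv.subtypeEquivRight fun a => funext_iff).trans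
        (Equiv.subtypePiEquivPi (p := fun x v => ConjClasses.mk v = w x)))
    rw [hcard, smul_eq_mul, ← Finset.prod_mul_distrib]
    simp only [ConjClasses.card_fiber_mul_centralizerCard, Finset.prod_const, Finset.card_univ,
      Nat.card_eq_fintype_card (α := Q)]
  simp only [hfiber]
  rw [← Finset.sum_filter, Finset.sum_const, smul_eq_mul, mul_comm, fixedWordCard,
    Nat.card_eq_fintype_card (α := Subtype _), Fintype.card_subtype]
  simp

/-- Both sides are invariant under the moves of the Euclidean algorithm on the exponents of `s`
and `t` with respect to a generator of `Q`, which reduce the claim to the case `s = 1`. -/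
theorem commPairCard_eq [IsCyclic Q] (s t : Q) :
    commPairCard D s t = Nat.card D ^ Nat.card Q * fixedWordCard (ConjClasses D) s t := by
  obtain ⟨g, hg⟩ := IsCyclic.exists_monoid_generator (α := Q)
  obtain ⟨m, rfl⟩ := hg s
  obtain ⟨n, rfl⟩ := hg t
  induction m, n using Nat.gcd.induction with
  | H0 n => simpa using commPairCard_one_left (D := D) (g ^ n)
  | H1 m n hm ih =>
    have hn : g ^ n = g ^ (n % m) * (g ^ m) ^ (n / m) := by
      rw [← pow_mul, ← pow_add, Nat.mod_add_div]
    simp only at ih ⊢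
    rw [commPairCard_comm, fixedWordCard_comm, hn, commPairCard_mul_pow, fixedWordCard_mul_pow, ih]

end Wreath

theorem fixedWordCard_congr {α β Q : Type*} [CommGroup Q] (e : α ≃ β) (s t : Q) :
    fixedWordCard α s t = fixedWordCard β s t :=
  Nat.card_congr ((Equiv.arrowCongr (Equiv.refl Q) e).subtypeEquiv fun x => by simp)

/-- Both sides count the commuting pairs of `D ≀ᵣ Q`, up to the factor `|D| ^ |Q|`. -/
theorem card_conjClasses_regularWreathProduct_mul (D Q : Type*) [Group D] [CommGroup Q] [Finite D]
    [Fintype Q] [IsCyclic Q] :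
    Nat.card (ConjClasses (D ≀ᵣ Q)) * Nat.card Q =
      ∑ p : Q × Q, fixedWordCard (ConjClasses D) p.1 p.2 := by
  have hpairs : Nat.card {p : (D ≀ᵣ Q) × (D ≀ᵣ Q) // Commute p.1 p.2} =
      ∑ q : Q × Q, commPairCard D q.1 q.2 := by
    unfold commPairCard
    rw [← Nat.card_sigma]
    exact Nat.card_congr
      { toFun := fun p => ⟨(p.1.1.right, p.1.2.right), p.1, p.2, rfl, rfl⟩
        invFun := fun p => ⟨p.2.1, p.2.2.1⟩
        left_inv := fun p => rfl
        right_inv := by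
          rintro ⟨⟨s, t⟩, p, h, h1, h2⟩
          obtain rfl : p.1.right = s := h1
          obtain rfl : p.2.right = t := h2
          rfl }
  rw [card_comm_eq_card_conjClasses_mul_card, RegularWreathProduct.card] at hpairs
  simp only [commPairCard_eq, ← Finset.mul_sum] at hpairs
  refine Nat.eq_of_mul_eq_mul_left (pow_pos (Nat.card_pos (α := D)) (Nat.card Q)) ?_
  rw [← hpairs]
  ring

/-- Double counting of the triples of a word and two rotations that fix it. -/
theorem sum_fixedWordCard_eq (n h : ℕ) [NeZero n] :
    ∑ p : Multiplicative (ZMod n) × Multiplicative (ZMod n), fixedWordCard (Fin h) p.1 p.2 =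
      ∑ x : ZMod n → Fin h, Nat.card (rotationStabilizer x) ^ 2 := by
  simp only [sq, ← Nat.card_prod]
  unfold fixedWordCard
  rw [← Nat.card_sigma, ← Nat.card_sigma]
  exact Nat.card_congr
    { toFun := fun p => ⟨fun i => p.2.1 (.ofAdd i),
        ⟨p.1.1.toAdd, fun i => by rw [add_comm]; exact p.2.2.1 (.ofAdd i)⟩,
        ⟨p.1.2.toAdd, fun i => by rw [add_comm]; exact p.2.2.2 (.ofAdd i)⟩⟩
      invFun := fun p => ⟨(.ofAdd p.2.1.1, .ofAdd p.2.2.1), fun q => p.1 q.toAdd,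
        fun q => by rw [mul_comm]; exact p.2.1.2 q.toAdd,
        fun q => by rw [mul_comm]; exact p.2.2.2 q.toAdd⟩
      left_inv := fun p => rfl
      right_inv := fun p => rfl }

/-! ### Words and their rotation stabilizers -/

/-- The subgroup generated by `n / c` is the only one of order `c`, and it lies in every subgroup of
order divisible by `c`. -/
theorem dvd_card_addSubgroup_zmod_iff {n c : ℕ} [NeZero n] (hc : c ∣ n) (H : AddSubgroup (ZMod n)) :
    c ∣ Nat.card H ↔ ((n / c : ℕ) : ZMod n) ∈ H := by
  classical
  obtain ⟨m, rfl⟩ := hc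
  have hn : c * m ≠ 0 := NeZero.ne (c * m)
  have hc0 : 0 < c := Nat.pos_of_ne_zero (left_ne_zero_of_mul hn)
  have hm0 : 0 < m := Nat.pos_of_ne_zero (right_ne_zero_of_mul hn)
  rw [Nat.mul_div_cancel_left m hc0]
  constructor
  · rintro ⟨k, hk⟩
    -- `H` exhausts the solutions of `|H| • y = 0`, of which there are at most `|H|`.
    have hsub : (Finset.univ.filter fun y => y ∈ H) ⊆
        Finset.univ.filter fun y : ZMod (c * m) => Nat.card H • y = 0 := by
      intro y hy
      simp only [Finset.mem_filter_univ] at hy ⊢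
      exact congrArg Subtype.val (card_nsmul_eq_zero' (G := H) (x := ⟨y, hy⟩))
    have hle := IsAddCyclic.card_nsmul_eq_zero_le (α := ZMod (c * m)) (n := Nat.card H) Nat.card_pos
    have hH : (Finset.univ.filter fun y => y ∈ H).card = Nat.card H := by
      rw [← Fintype.card_subtype, Nat.card_eq_fintype_card]
    have heq := Finset.eq_of_subset_of_card_le hsub (hle.trans hH.ge)
    have hmem : ((m : ℕ) : ZMod (c * m)) ∈
        Finset.univ.filter fun y : ZMod (c * m) => Nat.card H • y = 0 := by
      rw [Finset.mem_filter_univ, hk, nsmul_eq_mul, ← Nat.cast_mul, ZMod.natCast_eq_zero_iff]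
      exact ⟨k, by ring⟩
    rw [← heq] at hmem
    simpa using hmem
  · intro h
    have := addOrderOf_dvd_natCard (⟨(m : ZMod (c * m)), h⟩ : H)
    rwa [← AddSubgroup.addOrderOf_coe, ZMod.addOrderOf_coe _ hn, Nat.gcd_mul_left_left,
      Nat.mul_div_cancel _ hm0] at this

/-- A word of period `m` is the pullback of a word indexed by `ZMod m`. -/
theorem card_periodic_words (α : Type*) {n m : ℕ} [NeZero n] (hm : m ∣ n) :
    Nat.card {x : ZMod n → α // ∀ i, x (i + (m : ZMod n)) = x i} = Nat.card α ^ m := by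
  have : NeZero m := ⟨ne_zero_of_dvd_ne_zero (NeZero.ne n) hm⟩
  have hcast (i : ZMod n) : ZMod.castHom hm (ZMod m) i = (i.val : ZMod m) := by
    conv_lhs => rw [← ZMod.natCast_zmod_val i]
    exact map_natCast _ _
  let e : {x : ZMod n → α // ∀ i, x (i + (m : ZMod n)) = x i} ≃ (ZMod m → α) :=
    { toFun := fun x j => x.1 (j.val : ZMod n)
      invFun := fun y => ⟨fun i => y (ZMod.castHom hm (ZMod m) i), fun i => by
        beta_reduce
        rw [map_add, map_natCast, ZMod.natCast_self, add_zero]⟩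
      left_inv := fun x => Subtype.ext <| funext fun i => by
        have hper : Function.Periodic (fun k : ℕ => x.1 (k : ZMod n)) m := fun k => by
          simpa using x.2 k
        have h := hper.map_mod_nat i.val
        simp only [ZMod.natCast_zmod_val] at h
        simp only [hcast, ZMod.val_natCast]
        exact h
      right_inv := fun y => funext fun j => by simp }
  rw [Nat.card_congr e, Nat.card_fun, Nat.card_zmod]

theorem card_dvd_card_rotationStabilizer {n h c : ℕ} [NeZero n] (hc : c ∣ n) :
    Nat.card {x : ZMod n → Fin h // c ∣ Nat.card (rotationStabilizer x)} = h ^ (n / c) := by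
  simp only [dvd_card_addSubgroup_zmod_iff hc]
  exact (card_periodic_words (Fin h) (Nat.div_dvd_of_dvd hc)).trans (by simp)

theorem card_rotationStabilizer_mem_divisors {n h : ℕ} [NeZero n] (x : ZMod n → Fin h) :
    Nat.card (rotationStabilizer x) ∈ n.divisors := by
  refine Nat.mem_divisors.2 ⟨?_, NeZero.ne n⟩
  simpa using AddSubgroup.card_addSubgroup_dvd_card (rotationStabilizer x)

theorem sum_sq_card_rotationStabilizer (n h : ℕ) [NeZero n] :
    ∑ x : ZMod n → Fin h, (Nat.card (rotationStabilizer x) : ℚ) ^ 2 =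
      ∑ d ∈ n.divisors, (numWordsStab n h d : ℚ) * (d : ℚ) ^ 2 := by
  classical
  rw [← Finset.sum_fiberwise_of_maps_to
    (fun x _ => card_rotationStabilizer_mem_divisors x : ∀ x ∈ (Finset.univ : Finset _), _)]
  refine Finset.sum_congr rfl fun d _ => ?_
  rw [Finset.sum_congr rfl (g := fun _ => (d : ℚ) ^ 2) fun x hx => by
    rw [(Finset.mem_filter.1 hx).2]]
  rw [Finset.sum_const, nsmul_eq_mul, numWordsStab, Nat.card_eq_fintype_card, Fintype.card_subtype]

/-- Möbius inversion for `m ^ 2`; the inner sum is the Jordan totient `J₂ c`. -/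
theorem sum_divisors_moebius_mul_sq {m : ℕ} (hm : 0 < m) :
    ∑ c ∈ m.divisors, ∑ d ∈ c.divisors, (ArithmeticFunction.moebius (c / d) : ℚ) * (d : ℚ) ^ 2 =
      (m : ℚ) ^ 2 := by
  refine (ArithmeticFunction.sum_eq_iff_sum_mul_moebius_eq (R := ℚ)
    (f := fun c => ∑ d ∈ c.divisors, (ArithmeticFunction.moebius (c / d) : ℚ) * (d : ℚ) ^ 2)
    (g := fun m => (m : ℚ) ^ 2)).2 (fun c _ => ?_) m hm
  exact Nat.sum_divisorsAntidiagonal'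
    (f := fun i j => (ArithmeticFunction.moebius i : ℚ) * (j : ℚ) ^ 2)

/-- Expand each square by Möbius inversion and exchange the sums: the words that contribute to the
term of `c` are those whose stabilizer has order divisible by `c`. -/
theorem sum_sq_card_rotationStabilizer_eq_moebius (n h : ℕ) [NeZero n] :
    ∑ x : ZMod n → Fin h, (Nat.card (rotationStabilizer x) : ℚ) ^ 2 =
      ∑ c ∈ n.divisors, ∑ d ∈ c.divisors,
        (ArithmeticFunction.moebius (c / d) : ℚ) * (h : ℚ) ^ (n / c) * (d : ℚ) ^ 2 := by
  classical
  let J (c : ℕ) : ℚ := ∑ d ∈ c.divisors, (ArithmeticFunction.moebius (c / d) : ℚ) * (d : ℚ) ^ 2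
  have hsq (x : ZMod n → Fin h) : (Nat.card (rotationStabilizer x) : ℚ) ^ 2 =
      ∑ c ∈ n.divisors, if c ∣ Nat.card (rotationStabilizer x) then J c else 0 := by
    rw [← Finset.sum_filter, ← sum_divisors_moebius_mul_sq Nat.card_pos]
    refine Finset.sum_congr (Finset.ext fun c => ?_) fun _ _ => rfl
    rw [Nat.mem_divisors, Finset.mem_filter, Nat.mem_divisors]
    have hx := (Nat.mem_divisors.1 (card_rotationStabilizer_mem_divisors x)).1
    exact ⟨fun hc => ⟨⟨hc.1.trans hx, NeZero.ne n⟩, hc.1⟩, fun hc => ⟨hc.2, Nat.card_pos.ne'⟩⟩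
  simp only [hsq]
  rw [Finset.sum_comm]
  refine Finset.sum_congr rfl fun c hc => ?_
  rw [← Finset.sum_filter, Finset.sum_const, ← Fintype.card_subtype, ← Nat.card_eq_fintype_card,
    card_dvd_card_rotationStabilizer (Nat.mem_divisors.1 hc).1, nsmul_eq_mul, Finset.mul_sum]
  refine Finset.sum_congr rfl fun d _ => ?_
  push_cast
  ring

/-! ### Iterated wreath products -/

theorem CyclicWreath.finite {r : ℕ → ℕ} (hr : ∀ i, 1 ≤ i → 0 < r i) :
    ∀ k, Finite (CyclicWreath r k)
  | 0 => inferInstanceAs (Finite PUnit)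
  | k + 1 => by
    have := CyclicWreath.finite hr k
    have : NeZero (r (k + 1)) := ⟨(hr (k + 1) k.succ_pos).ne'⟩
    exact inferInstanceAs (Finite (CyclicWreath r k ≀ᵣ Multiplicative (ZMod (r (k + 1)))))

theorem numIrreps_eq_card_conjClasses {r : ℕ → ℕ} (hr : ∀ i, 1 ≤ i → 0 < r i) (k : ℕ) :
    numIrreps r k = Nat.card (ConjClasses (CyclicWreath r k)) := by
  have := CyclicWreath.finite hr k
  exact IrrepClass.card_eq_card_conjClasses

theorem numIrreps_zero {r : ℕ → ℕ} (hr : ∀ i, 1 ≤ i → 0 < r i) : numIrreps r 0 = 1 := by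
  rw [numIrreps_eq_card_conjClasses hr, Nat.card_eq_one_iff_unique]
  have : Subsingleton (CyclicWreath r 0) := inferInstanceAs (Subsingleton PUnit)
  exact ⟨ConjClasses.mk_surjective.subsingleton, ⟨1⟩⟩

theorem numIrreps_succ_mul {r : ℕ → ℕ} (hr : ∀ i, 1 ≤ i → 0 < r i) (k : ℕ)
    [NeZero (r (k + 1))] :
    numIrreps r (k + 1) * r (k + 1) =
      ∑ x : ZMod (r (k + 1)) → Fin (numIrreps r k), Nat.card (rotationStabilizer x) ^ 2 := by
  have := CyclicWreath.finite hr k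
  have h := card_conjClasses_regularWreathProduct_mul (CyclicWreath r k)
    (Multiplicative (ZMod (r (k + 1))))
  have e : ConjClasses (CyclicWreath r k) ≃ Fin (numIrreps r k) :=
    (Finite.equivFin _).trans (finCongr (numIrreps_eq_card_conjClasses hr k).symm)
  simp only [fixedWordCard_congr e, sum_fixedWordCard_eq] at h
  rw [← h, numIrreps_eq_card_conjClasses hr (k + 1)]
  have hQ : Nat.card (Multiplicative (ZMod (r (k + 1)))) = r (k + 1) := Nat.card_zmod _
  rw [hQ]
  rfl

theorem theorem2p3 (r : ℕ → ℕ) (hr : ∀ i, 1 ≤ i → 0 < r i) :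
    (∀ k, Finite (IrrepClass (CyclicWreath r k))) ∧
    numIrreps r 1 = r 1 ∧
    ∀ k, 1 ≤ k →
      (numIrreps r k : ℚ) =
        1 / (r k : ℚ) *
          ∑ d ∈ (r k).divisors, (numWordsStab (r k) (numIrreps r (k - 1)) d : ℚ) * (d : ℚ) ^ 2 ∧
      (numIrreps r k : ℚ) =
        1 / (r k : ℚ) *
          ∑ c ∈ (r k).divisors, ∑ d ∈ c.divisors,
            (ArithmeticFunction.moebius (c / d) : ℚ) *
              (numIrreps r (k - 1) : ℚ) ^ (r k / c) * (d : ℚ) ^ 2 := by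
  refine ⟨fun k => ?_, ?_, fun k hk => ?_⟩
  · have := CyclicWreath.finite hr k
    infer_instance
  · have : NeZero (r 1) := ⟨(hr 1 le_rfl).ne'⟩
    have h : numIrreps r 1 * r 1 =
        ∑ x : ZMod (r 1) → Fin (numIrreps r 0), Nat.card (rotationStabilizer x) ^ 2 :=
      numIrreps_succ_mul hr 0
    rw [numIrreps_zero hr] at h
    -- Over a one-letter alphabet there is a single word, and every rotation fixes it.
    have hstab (x : ZMod (r 1) → Fin 1) : Nat.card (rotationStabilizer x) = r 1 := by
      have : rotationStabilizer x = ⊤ :=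
        eq_top_iff.2 fun s _ i => Subsingleton.elim (x (i + s)) (x i)
      rw [this, AddSubgroup.card_top, Nat.card_zmod]
    simp only [hstab, Finset.sum_const, Finset.card_univ, Fintype.card_fun, Fintype.card_fin,
      one_pow, one_smul, sq] at h
    exact Nat.eq_of_mul_eq_mul_right (hr 1 le_rfl) h
  · obtain ⟨k, rfl⟩ := Nat.exists_eq_add_of_le' hk
    have : NeZero (r (k + 1)) := ⟨(hr (k + 1) hk).ne'⟩
    have hr0 : (r (k + 1) : ℚ) ≠ 0 := Nat.cast_ne_zero.2 (NeZero.ne _)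
    have h : (numIrreps r (k + 1) : ℚ) = 1 / (r (k + 1) : ℚ) *
        ∑ x : ZMod (r (k + 1)) → Fin (numIrreps r k),
          (Nat.card (rotationStabilizer x) : ℚ) ^ 2 := by
      rw [one_div, eq_inv_mul_iff_mul_eq₀ hr0, mul_comm]
      exact_mod_cast numIrreps_succ_mul hr k
    rw [Nat.add_sub_cancel]
    exact ⟨by rw [h, sum_sq_card_rotationStabilizer],
      by rw [h, sum_sq_card_rotationStabilizer_eq_moebius]⟩
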